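/- Let $\mathcal M=(M,\mathcal S)$ be a countable model of $\mathsf{RCA}_0$: $M$ is a countable model of $P^-$ (the non-negative part of a discretely ordered commutative ring), $\mathcal S\subseteq\mathcal P(M)$ is countable, and $(M,\mathcal S)$ satisfies $\Delta^0_1$ comprehension and $\Sigma^0_1$ induction, where the formulas may have finitely many number parameters from $M$ and set parameters from $\mathcal S$. Then there are a countable $\mathcal S^*$ with $\mathcal S\subseteq\mathcal S^*\subseteq\mathcal P(M)$ and a set $B\in\mathcal S^*$ such that $(M,\mathcal S^*)$ is a model of $\mathsf{RCA}_0$ topped by $B$, that is, every set in $\mathcal S^*$ (in particular every set in $\mathcal S$) is $\Delta_1$ definable with number parameters from $M$ and the set parameter $B$. Moreover every $\Sigma^0_1$ set of $(M,\mathcal S^*)$ is regular, and in particular so is the jump $B'=\{e\in M:\varphi^B(e,e)\}$, for every universal $\Sigma_1$ formula $\varphi^Z(e,x)$. Here $A\subseteq M$ is *regular* if for every $b\in M$ the set $\{x\in A:x<b\}$ is finite in the sense of $M$, i.e. is of the form $\{i<k: m(i+1)+1 \text{ divides } c\}$ for some $k,m,c\in M$. A $\Sigma_1$ formula $\varphi^Z(e,x)$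 without parameters is *universal* (over $M$) if for every $\Sigma_1$ formula $\psi^Z(x)$ with number parameters from $M$ there is $e\in M$ such that $\varphi^A(e,x)\leftrightarrow\psi^A(x)$ holds in $M$ for all regular $A\subseteq M$ and all $x\in M$. -/

import Mathlib

universe u

namespace SecondOrderArith

/-- Terms of the language `0, 1, +, ·` in the number variables `x₀, …, xₙ₋₁`. -/
inductive ArithTerm (n : ℕ) : Type
  | var : Fin n → ArithTerm n
  | zero : ArithTerm n
  | one : ArithTerm n
  | add : ArithTerm n → ArithTerm n → ArithTerm n
  | mul : ArithTerm n → ArithTerm n → ArithTerm n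

/-- The bounded-quantifier (`Σ⁰₀`) formulas of second-order arithmetic, in the number variables
`x₀, …, xₙ₋₁` and the set variables `Z₀, …, Zₖ₋₁`. In `ball t φ`, the formula `(∀ x < t) φ`,
the newly bound variable is variable `0` of `φ` and variable `i` of `t` is variable `i + 1` of `φ`,
so the bound `t` cannot mention it. The other connectives and the bounded existential quantifier
are expressed with `neg`. -/
inductive BddFormula (k : ℕ) : ℕ → Type
  | eq {n : ℕ} : ArithTerm n → ArithTerm n → BddFormula k n
  | lt {n : ℕ} : ArithTerm n → ArithTerm n → BddFormula k n
  | mem {n : ℕ} : ArithTerm n → Fin k → BddFormula k n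
  | neg {n : ℕ} : BddFormula k n → BddFormula k n
  | and {n : ℕ} : BddFormula k n → BddFormula k n → BddFormula k n
  | ball {n : ℕ} : ArithTerm n → BddFormula k (n + 1) → BddFormula k n

variable {M : Type u} [CommSemiring M] [LinearOrder M]

/-- The value of a term. -/
def ArithTerm.eval {n : ℕ} (v : Fin n → M) : ArithTerm n → M
  | .var i => v i
  | .zero => 0
  | .one => 1
  | .add s t => s.eval v + t.eval v
  | .mul s t => s.eval v * t.eval v

/-- Satisfaction, with `Zᵢ` interpreted as `X i`. -/
def BddFormula.Realize {k : ℕ} (X : Fin k → Set M) :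
    {n : ℕ} → BddFormula k n → (Fin n → M) → Prop
  | _, .eq s t, v => s.eval v = t.eval v
  | _, .lt s t, v => s.eval v < t.eval v
  | _, .mem t i, v => t.eval v ∈ X i
  | _, .neg φ, v => ¬ φ.Realize X v
  | _, .and φ ψ, v => φ.Realize X v ∧ ψ.Realize X v
  | _, .ball t φ, v => ∀ a : M, a < t.eval v → φ.Realize X (Fin.cons a v)

/-- `A` is definable by a `Σ₁` formula `∃ y, φ(y, x, p)`, with `φ` a bounded-quantifier formula,
`p` a finite list of numbers and finitely many set parameters, all of them members of `P`.
For `P = {B}` these are the `Σ₁^B` sets; for `P` the second-order part of a model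
they are the `Σ⁰₁` sets of the model. -/
def IsSigmaOne (P : Set (Set M)) (A : Set M) : Prop :=
  ∃ (n k : ℕ) (φ : BddFormula k (n + 2)) (p : Fin n → M) (X : Fin k → Set M),
    (∀ i, X i ∈ P) ∧ ∀ x : M, x ∈ A ↔ ∃ y : M, φ.Realize X (Fin.cons y (Fin.cons x p))

/-- `Δ₁` definability with set parameters from `P`. -/
def IsDeltaOne (P : Set (Set M)) (A : Set M) : Prop :=
  IsSigmaOne P A ∧ IsSigmaOne P Aᶜ

/-- `(M, S)` is a model of `RCA₀`. The axioms `P⁻` say that `M` is the non-negative part of a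
discretely ordered commutative ring: all of them except discreteness are the type classes. -/
structure IsModelRCA0 [IsStrictOrderedRing M] [CanonicallyOrderedAdd M]
    (S : Set (Set M)) : Prop where
  discrete : ∀ x : M, 0 < x → 1 ≤ x
  delta_one_comprehension : ∀ A : Set M, IsDeltaOne S A → A ∈ S
  sigma_one_induction : ∀ A : Set M, IsSigmaOne S A →
    0 ∈ A → (∀ x ∈ A, x + 1 ∈ A) → ∀ x : M, x ∈ A

/-- The model `(M, S)` is topped by its member `B`. -/
def IsToppedBy (S : Set (Set M)) (B : Set M) : Prop :=
  B ∈ S ∧ ∀ A ∈ S, IsDeltaOne {B} A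

/-- `A` is finite in the sense of `M`: it is coded by numbers of `M`, in the usual way by
means of divisibility (the code of a finite set in subsystems of second-order arithmetic). -/
def IsCoded (A : Set M) : Prop :=
  ∃ b m c : M, ∀ i : M, i ∈ A ↔ i < b ∧ m * (i + 1) + 1 ∣ c

/-- Every proper initial segment of `A` is finite in the sense of `M`. -/
def IsRegular (A : Set M) : Prop :=
  ∀ b : M, IsCoded {x : M | x ∈ A ∧ x < b}

/-- The `Σ₁` formula `∃ s, U(s, e, x)` with set variable `Z` and without parameters is universal
over `M`: every `Σ₁` formula in `x` and `Z`, with number parameters from `M`, has an index `e`,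
the same for all regular interpretations of `Z`. -/
def IsUniversal (M : Type u) [CommSemiring M] [LinearOrder M] (U : BddFormula 1 3) : Prop :=
  ∀ (n : ℕ) (φ : BddFormula 1 (n + 2)) (p : Fin n → M), ∃ e : M, ∀ A : Set M, IsRegular A →
    ∀ x : M, (∃ s : M, U.Realize (fun _ => A) ![s, e, x]) ↔
      ∃ s : M, φ.Realize (fun _ => A) (Fin.cons s (Fin.cons x p))

/-- The jump `A'`, formed with the universal formula `U`: the set of all `e` such that
the `e`-th `Σ₁^A` set contains `e`. -/
def jump (U : BddFormula 1 3) (A : Set M) : Set M :=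
  {e : M | ∃ s : M, U.Realize (fun _ => A) ![s, e, e]}

end SecondOrderArith

namespace SecondOrderArith

/-! List the members of `S` as `A 0, A 1, …` and build `B` as the union of a chain of conditions,
each a bounded piece of `B` coded in `M`. From stage `j` on, new values on the columns `i < j` must
copy `A i`. Hence column `i` of `B` agrees with `A i` beyond some bound, and the part of `A i` below
the bound is coded by numbers, so `A i` is `Δ₁` in `B`.

Making `B` preserve `Σ₁` induction is the main point (`Cond.exists_ext_induction`). Given an
instance of induction up to `a`, let `Q x` say that some extension respecting the current promise
forces the formula at every argument up to `x`. The promise involves only a standard finite number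
of columns, so `Q` is `Σ₁` over `S`. If `Q a` holds, force the conclusion; if `Q 0` fails, the base
case fails for `B`; otherwise induction over `S` gives `Q x` and not `Q (x + 1)`, and a witness of
`Q x` makes the induction step fail at `x`. There are countably many instances, so one chain meets
them all (`HasInduction.exists_generic`).

The extension consists of the `Δ₁` sets in `B`. By `Σ₁` collection, `Σ₁` in such sets is `Σ₁` in
`B`, so the axioms hold. Regularity is the coding lemma `HasInduction.exists_bits`, applied over
`B`. -/

/-- A type of finite tuples of elements of `M`, given by its coordinate functions. -/
class Ctx (M : Type u) (γ : Type u) where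
  coords : Set (γ → M)

instance (M : Type u) : Ctx M M := ⟨{id}⟩

instance (M γ : Type u) [Ctx M γ] : Ctx M (γ × M) :=
  ⟨{f | f = Prod.snd ∨ ∃ g ∈ Ctx.coords (M := M) (γ := γ), f = g ∘ Prod.fst}⟩

/-! ### Terms, bounded relations and `Σ₁` relations as predicates on tuples -/

section Calculus

variable {M : Type u} [CommSemiring M]

/-- Functions given by a term with parameters. -/
inductive Tm {γ : Type u} [Ctx M γ] : (γ → M) → Prop
  | coord {f : γ → M} : f ∈ Ctx.coords (M := M) (γ := γ) → Tm f
  | const (c : M) : Tm fun _ => c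
  | add {f g : γ → M} : Tm f → Tm g → Tm fun z => f z + g z
  | mul {f g : γ → M} : Tm f → Tm g → Tm fun z => f z * g z

/-- Maps between contexts all of whose coordinates are terms. -/
def TmMap (M : Type u) [CommSemiring M] {γ δ : Type u} [Ctx M γ] [Ctx M δ] (f : γ → δ) : Prop :=
  ∀ c ∈ Ctx.coords (M := M) (γ := δ), Tm (M := M) fun z => c (f z)

variable {γ δ : Type u} [Ctx M γ] [Ctx M δ]

theorem Tm.snd : Tm (M := M) fun q : γ × M => q.2 := .coord (Or.inl rfl)

theorem Tm.self : Tm fun x : M => x := .coord rfl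

theorem TmMap.fst : TmMap M fun q : γ × M => q.1 :=
  fun c hc => .coord (Or.inr ⟨c, hc, rfl⟩)

theorem TmMap.id : TmMap M fun z : γ => z := fun _ hc => .coord hc

theorem TmMap.const (d : δ) : TmMap M fun _ : γ => d := fun c _ => .const (c d)

theorem TmMap.pair {f : γ → δ} {t : γ → M} (hf : TmMap M f) (ht : Tm t) :
    TmMap M fun z => (f z, t z) := by
  rintro c (rfl | ⟨g, hg, rfl⟩)
  · exact ht
  · exact hf g hg

theorem TmMap.of_tm {t : γ → M} (ht : Tm t) : TmMap M t := by
  rintro c rfl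
  exact ht

theorem Tm.comp {t : δ → M} (ht : Tm t) {f : γ → δ} (hf : TmMap M f) : Tm fun z => t (f z) := by
  induction ht with
  | coord h => exact hf _ h
  | const c => exact .const c
  | add _ _ h₁ h₂ => exact .add h₁ h₂
  | mul _ _ h₁ h₂ => exact .mul h₁ h₂

theorem TmMap.comp {ε : Type u} [Ctx M ε] {g : δ → ε} (hg : TmMap M g) {f : γ → δ}
    (hf : TmMap M f) : TmMap M fun z => g (f z) :=
  fun c hc => (hg c hc).comp hf

theorem Tm.fst {t : γ → M} (ht : Tm t) : Tm (M := M) fun q : γ × M => t q.1 := ht.comp .fst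

/-- Extending the source and the target of a map by one more variable. -/
theorem TmMap.lift {f : γ → δ} (hf : TmMap M f) :
    TmMap M fun q : γ × M => (f q.1, q.2) := (hf.comp .fst).pair .snd

/-- The context maps that insert a fresh variable below the last one. -/
theorem TmMap.insert : TmMap M fun q : (γ × M) × M => (q.1.1, q.2) :=
  TmMap.fst.lift

theorem ArithTerm.tm {N : ℕ} (s : ArithTerm N) {w : γ → Fin N → M}
    (hw : ∀ j, Tm fun z => w z j) : Tm fun z => s.eval (w z) := by
  induction s with
  | var j => exact hw j
  | zero => exact .const 0
  | one => exact .const 1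
  | add _ _ h₁ h₂ => exact .add h₁ h₂
  | mul _ _ h₁ h₂ => exact .mul h₁ h₂

/-- The list `F` of parameters is fixed before the assignment `w`, so that terms with different
parameters can be brought to one common list of variables. -/
theorem Tm.exists_arithTerm {t : γ → M} (ht : Tm t) : ∃ F : List M,
    ∀ (N : ℕ) (w : γ → Fin N → M), (∀ c ∈ Ctx.coords (M := M) (γ := γ), ∃ j, ∀ z, w z j = c z) →
      (∀ c ∈ F, ∃ j, ∀ z, w z j = c) → ∃ s : ArithTerm N, ∀ z, s.eval (w z) = t z := by
  induction ht with
  | coord h =>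
    refine ⟨[], fun N w hw _ => ?_⟩
    obtain ⟨j, hj⟩ := hw _ h
    exact ⟨.var j, hj⟩
  | const c =>
    refine ⟨[c], fun N w _ hF => ?_⟩
    obtain ⟨j, hj⟩ := hF c (by simp)
    exact ⟨.var j, hj⟩
  | add _ _ h₁ h₂ =>
    obtain ⟨F₁, h₁⟩ := h₁
    obtain ⟨F₂, h₂⟩ := h₂
    refine ⟨F₁ ++ F₂, fun N w hw hF => ?_⟩
    obtain ⟨s₁, hs₁⟩ := h₁ N w hw fun c hc => hF c (by simp [hc])
    obtain ⟨s₂, hs₂⟩ := h₂ N w hw fun c hc => hF c (by simp [hc])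
    exact ⟨.add s₁ s₂, fun z => by simp [ArithTerm.eval, hs₁, hs₂]⟩
  | mul _ _ h₁ h₂ =>
    obtain ⟨F₁, h₁⟩ := h₁
    obtain ⟨F₂, h₂⟩ := h₂
    refine ⟨F₁ ++ F₂, fun N w hw hF => ?_⟩
    obtain ⟨s₁, hs₁⟩ := h₁ N w hw fun c hc => hF c (by simp [hc])
    obtain ⟨s₂, hs₂⟩ := h₂ N w hw fun c hc => hF c (by simp [hc])
    exact ⟨.mul s₁ s₂, fun z => by simp [ArithTerm.eval, hs₁, hs₂]⟩

variable [LinearOrder M] {P : Set (Set M)}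

/-- Relations given by a bounded formula with number parameters and set parameters from `P`. -/
inductive Bd (P : Set (Set M)) : {γ : Type u} → [Ctx M γ] → (γ → Prop) → Prop
  | eq {γ : Type u} [Ctx M γ] {s t : γ → M} : Tm s → Tm t → Bd P fun z => s z = t z
  | lt {γ : Type u} [Ctx M γ] {s t : γ → M} : Tm s → Tm t → Bd P fun z => s z < t z
  | mem {γ : Type u} [Ctx M γ] {t : γ → M} {A : Set M} : A ∈ P → Tm t → Bd P fun z => t z ∈ A
  | not {γ : Type u} [Ctx M γ] {R : γ → Prop} : Bd P R → Bd P fun z => ¬ R z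
  | and {γ : Type u} [Ctx M γ] {R Q : γ → Prop} : Bd P R → Bd P Q → Bd P fun z => R z ∧ Q z
  | ball {γ : Type u} [Ctx M γ] {t : γ → M} {R : γ → M → Prop} : Tm t →
      Bd P (fun q : γ × M => R q.1 q.2) → Bd P fun z => ∀ a, a < t z → R z a

/-- `Σ₁` relations with set parameters from `P`. -/
def Sg (P : Set (Set M)) {γ : Type u} [Ctx M γ] (R : γ → Prop) : Prop :=
  ∃ Q : γ → M → Prop, Bd P (fun q : γ × M => Q q.1 q.2) ∧ ∀ z, R z ↔ ∃ y, Q z y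

/-- `Δ₁` relations with set parameters from `P`. -/
def Dl (P : Set (Set M)) {γ : Type u} [Ctx M γ] (R : γ → Prop) : Prop :=
  Sg P R ∧ Sg P fun z => ¬ R z

theorem Bd.comp {R : δ → Prop} (hR : Bd P R) :
    ∀ {γ : Type u} [Ctx M γ] {f : γ → δ}, TmMap M f → Bd P fun z => R (f z) := by
  induction hR with
  | eq hs ht => exact fun hf => .eq (hs.comp hf) (ht.comp hf)
  | lt hs ht => exact fun hf => .lt (hs.comp hf) (ht.comp hf)
  | mem hA ht => exact fun hf => .mem hA (ht.comp hf)
  | not _ ih => exact fun hf => .not (ih hf)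
  | and _ _ ih₁ ih₂ => exact fun hf => .and (ih₁ hf) (ih₂ hf)
  | ball ht _ ih => exact fun hf => .ball (ht.comp hf) (ih hf.lift)

theorem Bd.of_iff {R Q : γ → Prop} (h : Bd P R) (e : ∀ z, Q z ↔ R z) : Bd P Q := by
  rwa [show Q = R from funext fun z => propext (e z)]

theorem Bd.bex {t : γ → M} {R : γ → M → Prop} (ht : Tm t)
    (h : Bd P fun q : γ × M => R q.1 q.2) : Bd P fun z => ∃ a, a < t z ∧ R z a :=
  (Bd.not (.ball (R := fun z a => ¬ R z a) ht h.not)).of_iff fun z => by simp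

/-! ### From relations back to formulas -/

theorem Bd.exists_formula {R : γ → Prop} (hR : Bd P R) : ∃ (F : List M) (G : List (Set M)),
    (∀ A ∈ G, A ∈ P) ∧ ∀ (N : ℕ) (w : γ → Fin N → M),
      (∀ c ∈ Ctx.coords (M := M) (γ := γ), ∃ j, ∀ z, w z j = c z) →
      (∀ c ∈ F, ∃ j, ∀ z, w z j = c) → ∀ (k : ℕ) (X : Fin k → Set M), (∀ A ∈ G, ∃ i, X i = A) →
      ∃ φ : BddFormula k N, ∀ z, φ.Realize X (w z) ↔ R z := by
  induction hR with
  | eq hs ht =>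
    obtain ⟨F₁, h₁⟩ := hs.exists_arithTerm
    obtain ⟨F₂, h₂⟩ := ht.exists_arithTerm
    refine ⟨F₁ ++ F₂, [], by simp, fun N w hw hF k X _ => ?_⟩
    obtain ⟨s₁, hs₁⟩ := h₁ N w hw fun c hc => hF c (by simp [hc])
    obtain ⟨s₂, hs₂⟩ := h₂ N w hw fun c hc => hF c (by simp [hc])
    exact ⟨.eq s₁ s₂, fun z => by simp [BddFormula.Realize, hs₁, hs₂]⟩
  | lt hs ht =>
    obtain ⟨F₁, h₁⟩ := hs.exists_arithTerm
    obtain ⟨F₂, h₂⟩ := ht.exists_arithTerm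
    refine ⟨F₁ ++ F₂, [], by simp, fun N w hw hF k X _ => ?_⟩
    obtain ⟨s₁, hs₁⟩ := h₁ N w hw fun c hc => hF c (by simp [hc])
    obtain ⟨s₂, hs₂⟩ := h₂ N w hw fun c hc => hF c (by simp [hc])
    exact ⟨.lt s₁ s₂, fun z => by simp [BddFormula.Realize, hs₁, hs₂]⟩
  | @mem _ _ _ A hA ht =>
    obtain ⟨F, h⟩ := ht.exists_arithTerm
    refine ⟨F, [A], by simpa, fun N w hw hF k X hX => ?_⟩
    obtain ⟨s, hs⟩ := h N w hw hF
    obtain ⟨i, hi⟩ := hX A (by simp)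
    exact ⟨.mem s i, fun z => by simp [BddFormula.Realize, hs, hi]⟩
  | not _ ih =>
    obtain ⟨F, G, hG, h⟩ := ih
    refine ⟨F, G, hG, fun N w hw hF k X hX => ?_⟩
    obtain ⟨φ, hφ⟩ := h N w hw hF k X hX
    exact ⟨.neg φ, fun z => by simp [BddFormula.Realize, hφ]⟩
  | and _ _ ih₁ ih₂ =>
    obtain ⟨F₁, G₁, hG₁, h₁⟩ := ih₁
    obtain ⟨F₂, G₂, hG₂, h₂⟩ := ih₂
    refine ⟨F₁ ++ F₂, G₁ ++ G₂, fun A hA => (List.mem_append.1 hA).elim (hG₁ A) (hG₂ A),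
      fun N w hw hF k X hX => ?_⟩
    obtain ⟨φ₁, hφ₁⟩ := h₁ N w hw (fun c hc => hF c (by simp [hc])) k X
      fun A hA => hX A (by simp [hA])
    obtain ⟨φ₂, hφ₂⟩ := h₂ N w hw (fun c hc => hF c (by simp [hc])) k X
      fun A hA => hX A (by simp [hA])
    exact ⟨.and φ₁ φ₂, fun z => by simp [BddFormula.Realize, hφ₁, hφ₂]⟩
  | ball ht _ ih =>
    obtain ⟨F₁, h₁⟩ := ht.exists_arithTerm
    obtain ⟨F₂, G, hG, h₂⟩ := ih
    refine ⟨F₁ ++ F₂, G, hG, fun N w hw hF k X hX => ?_⟩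
    obtain ⟨s, hs⟩ := h₁ N w hw fun c hc => hF c (by simp [hc])
    obtain ⟨φ, hφ⟩ := h₂ (N + 1) (fun q => Fin.cons q.2 (w q.1)) (by
      rintro c (rfl | ⟨g, hg, rfl⟩)
      · exact ⟨0, fun z => rfl⟩
      · obtain ⟨j, hj⟩ := hw g hg
        exact ⟨j.succ, fun z => by simp [hj]⟩) (fun c hc => by
        obtain ⟨j, hj⟩ := hF c (by simp [hc])
        exact ⟨j.succ, fun z => by simp [hj]⟩) k X hX
    refine ⟨.ball s φ, fun z => ?_⟩
    simp only [BddFormula.Realize, hs]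
    exact forall_congr' fun a => imp_congr_right fun _ => hφ (z, a)

theorem Sg.isSigmaOne {A : Set M} (h : Sg P fun x : M => x ∈ A) : IsSigmaOne P A := by
  obtain ⟨Q, hQ, hA⟩ := h
  obtain ⟨F, G, hG, h⟩ := hQ.exists_formula
  obtain ⟨φ, hφ⟩ := h (F.length + 2) (fun q => Fin.cons q.2 (Fin.cons q.1 F.get)) (by
    rintro c (rfl | ⟨g, rfl, rfl⟩)
    · exact ⟨0, fun z => rfl⟩
    · exact ⟨1, fun z => rfl⟩) (fun c hc => by
      obtain ⟨j, hj⟩ := List.get_of_mem hc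
      exact ⟨j.succ.succ, fun z => by simpa using hj⟩) G.length G.get fun A hA => by
      exact List.get_of_mem hA
  refine ⟨F.length, G.length, φ, F.get, G.get, fun i => hG _ (G.get_mem i), fun x => ?_⟩
  exact (hA x).trans (exists_congr fun y => (hφ (x, y)).symm)

/-! ### Closure properties of `Σ₁` and `Δ₁` relations -/

theorem Sg.of_iff {R Q : γ → Prop} (h : Sg P R) (e : ∀ z, Q z ↔ R z) : Sg P Q := by
  rwa [show Q = R from funext fun z => propext (e z)]

theorem Sg.comp {R : δ → Prop} (hR : Sg P R) {f : γ → δ} (hf : TmMap M f) :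
    Sg P fun z => R (f z) := by
  obtain ⟨Q, hQ, h⟩ := hR
  exact ⟨fun z y => Q (f z) y, hQ.comp hf.lift, fun z => h (f z)⟩

theorem Dl.comp {R : δ → Prop} (hR : Dl P R) {f : γ → δ} (hf : TmMap M f) :
    Dl P fun z => R (f z) := ⟨hR.1.comp hf, hR.2.comp hf⟩

theorem Dl.of_iff {R Q : γ → Prop} (h : Dl P R) (e : ∀ z, Q z ↔ R z) : Dl P Q := by
  rwa [show Q = R from funext fun z => propext (e z)]

theorem Bd.sg {R : γ → Prop} (h : Bd P R) : Sg P R :=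
  ⟨fun z _ => R z, h.comp .fst, fun _ => by simp⟩

theorem Bd.dl {R : γ → Prop} (h : Bd P R) : Dl P R := ⟨h.sg, h.not.sg⟩

theorem Dl.not {R : γ → Prop} (h : Dl P R) : Dl P fun z => ¬ R z :=
  ⟨h.2, h.1.of_iff fun _ => not_not⟩

theorem Dl.le {s t : γ → M} (hs : Tm s) (ht : Tm t) : Dl P fun z => s z ≤ t z :=
  (Bd.lt ht hs).dl.not.of_iff fun _ => not_lt.symm

/-- The axioms used throughout: discreteness and `Σ₁` induction with set parameters from `P`. -/
structure HasInduction [IsStrictOrderedRing M] [CanonicallyOrderedAdd M] (P : Set (Set M)) :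
    Prop where
  discrete : ∀ x : M, 0 < x → 1 ≤ x
  induction : ∀ A : Set M, IsSigmaOne P A → 0 ∈ A → (∀ x ∈ A, x + 1 ∈ A) → ∀ x : M, x ∈ A

variable [IsStrictOrderedRing M] [CanonicallyOrderedAdd M]

theorem HasInduction.lt_add_one_iff (H : HasInduction P) {a b : M} : a < b + 1 ↔ a ≤ b := by
  refine ⟨fun h => ?_, fun h => h.trans_lt (lt_add_one b)⟩
  by_contra! hlt
  obtain ⟨d, rfl⟩ := exists_add_of_le hlt.le
  have hd : 0 < d := by
    rcases (zero_le (a := d)).eq_or_lt with rfl | h'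
    · simp at hlt
    · exact h'
  exact absurd h (not_lt.2 (add_le_add_right (H.discrete d hd) b))

theorem HasInduction.induct (H : HasInduction P) {R : M → Prop} (hR : Sg P R) (h0 : R 0)
    (hs : ∀ x, R x → R (x + 1)) (x : M) : R x :=
  H.induction {x | R x} (Sg.isSigmaOne hR) h0 hs x

/-- Contraction of two existential quantifiers. -/
theorem Sg.ex {R : γ → M → Prop} (h : Sg P fun q : γ × M => R q.1 q.2) :
    Sg P fun z => ∃ y, R z y := by
  obtain ⟨Q, hQ, h⟩ := h
  refine ⟨fun z b => ∃ y, y < b ∧ ∃ x, x < b ∧ Q (z, y) x, ?_, fun z => ?_⟩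
  · refine .bex .snd (.bex Tm.snd.fst ?_)
    exact hQ.comp (((TmMap.fst.comp (.comp .fst .fst)).pair Tm.snd.fst).pair .snd)
  · constructor
    · rintro ⟨y, hy⟩
      obtain ⟨x, hx⟩ := (h (z, y)).1 hy
      refine ⟨y + x + 1, y, ?_, x, ?_, hx⟩
      · exact (le_self_add).trans_lt (lt_add_one _)
      · exact (le_add_self).trans_lt (lt_add_one _)
    · rintro ⟨b, y, -, x, -, hx⟩
      exact ⟨y, (h (z, y)).2 ⟨x, hx⟩⟩

theorem Sg.and {R Q : γ → Prop} (hR : Sg P R) (hQ : Sg P Q) : Sg P fun z => R z ∧ Q z := by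
  obtain ⟨R', hR', hR⟩ := hR
  obtain ⟨Q', hQ', hQ⟩ := hQ
  have : Sg P fun z => ∃ y x, R' z y ∧ Q' z x :=
    .ex (.ex (Bd.and (hR'.comp .fst) (hQ'.comp TmMap.insert)).sg)
  exact this.of_iff fun z => by simp [hR, hQ]

theorem Sg.or {R Q : γ → Prop} (hR : Sg P R) (hQ : Sg P Q) : Sg P fun z => R z ∨ Q z := by
  obtain ⟨R', hR', hR⟩ := hR
  obtain ⟨Q', hQ', hQ⟩ := hQ
  have : Sg P fun z => ∃ y, ¬ (¬ R' z y ∧ ¬ Q' z y) := .ex (Bd.not (hR'.not.and hQ'.not)).sg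
  refine this.of_iff fun z => ?_
  rw [hR, hQ, ← exists_or]
  exact exists_congr fun y => by tauto

theorem Sg.bex {t : γ → M} {R : γ → M → Prop} (ht : Tm t)
    (h : Sg P fun q : γ × M => R q.1 q.2) : Sg P fun z => ∃ a, a < t z ∧ R z a :=
  .ex (.and (Bd.lt .snd ht.fst).sg h)

/-- `Σ₁` collection. -/
theorem HasInduction.exists_bound (H : HasInduction P) {R : M → M → Prop}
    (hR : Bd P fun q : M × M => R q.1 q.2) (t : M) (h : ∀ a < t, ∃ y, R a y) :
    ∃ b, ∀ a < t, ∃ y < b, R a y := by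
  -- The guard `a < t` sits inside the formula, so that plain induction over all `x` applies: past
  -- `t` nothing new is asked of `b`.
  have key : ∀ x, ∃ b, ∀ a, a < x → ¬ (a < t ∧ ¬ ∃ y, y < b ∧ R a y) := by
    refine H.induct ?_ ⟨0, fun a ha => absurd ha (not_lt.2 zero_le)⟩ ?_
    · refine .ex (Bd.ball Tm.self.fst ?_).sg
      refine .not (.and (.lt .snd (.const t)) (.not (.bex Tm.snd.fst ?_)))
      exact hR.comp ((TmMap.of_tm Tm.snd.fst).pair .snd)
    · rintro x ⟨b, hb⟩
      by_cases hx : x < t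
      · obtain ⟨y, hy⟩ := h x hx
        refine ⟨b + y + 1, fun a ha => ?_⟩
        rintro ⟨hat, hn⟩
        rcases (H.lt_add_one_iff.1 ha).eq_or_lt with rfl | hlt
        · exact hn ⟨y, le_add_self.trans_lt (lt_add_one _), hy⟩
        · refine hb a hlt ⟨hat, fun ⟨y', hy', hR'⟩ => hn ⟨y', hy'.trans_le ?_, hR'⟩⟩
          rw [add_assoc]
          exact le_self_add
      · refine ⟨b, fun a ha => ?_⟩
        rcases (H.lt_add_one_iff.1 ha).eq_or_lt with rfl | hlt
        · exact fun h' => hx h'.1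
        · exact hb a hlt
  obtain ⟨b, hb⟩ := key t
  exact ⟨b, fun a ha => by simpa [ha] using hb a ha⟩

/-- `Σ₁` relations are closed under bounded universal quantification. -/
theorem Sg.ball (H : HasInduction P) {t : γ → M} {R : γ → M → Prop} (ht : Tm t)
    (h : Sg P fun q : γ × M => R q.1 q.2) : Sg P fun z => ∀ a, a < t z → R z a := by
  obtain ⟨Q, hQ, h⟩ := h
  have : Sg P fun z => ∃ b, ∀ a, a < t z → ∃ y, y < b ∧ Q (z, a) y := by
    refine .ex (Bd.ball ht.fst (.bex Tm.snd.fst ?_)).sg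
    exact hQ.comp (((TmMap.fst.comp (.comp .fst .fst)).pair Tm.snd.fst).pair .snd)
  refine this.of_iff fun z => ⟨fun hz => ?_, fun ⟨b, hb⟩ a ha => ?_⟩
  · exact H.exists_bound (R := fun a y => Q (z, a) y)
      (hQ.comp (((TmMap.const z).pair Tm.self.fst).pair .snd)) (t z)
      fun a ha => (h (z, a)).1 (hz a ha)
  · obtain ⟨y, -, hy⟩ := hb a ha
    exact (h (z, a)).2 ⟨y, hy⟩

theorem Dl.and {R Q : γ → Prop} (hR : Dl P R) (hQ : Dl P Q) : Dl P fun z => R z ∧ Q z :=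
  ⟨hR.1.and hQ.1, (hR.2.or hQ.2).of_iff fun _ => not_and_or⟩

theorem Dl.or {R Q : γ → Prop} (hR : Dl P R) (hQ : Dl P Q) : Dl P fun z => R z ∨ Q z :=
  ⟨hR.1.or hQ.1, (hR.2.and hQ.2).of_iff fun _ => not_or⟩

theorem Dl.imp {R Q : γ → Prop} (hR : Dl P R) (hQ : Dl P Q) : Dl P fun z => R z → Q z :=
  (hR.not.or hQ).of_iff fun _ => imp_iff_not_or

theorem Dl.iff {R Q : γ → Prop} (hR : Dl P R) (hQ : Dl P Q) : Dl P fun z => R z ↔ Q z :=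
  ((hR.imp hQ).and (hQ.imp hR)).of_iff fun _ => iff_iff_implies_and_implies

theorem Dl.ball (H : HasInduction P) {t : γ → M} {R : γ → M → Prop} (ht : Tm t)
    (h : Dl P fun q : γ × M => R q.1 q.2) : Dl P fun z => ∀ a, a < t z → R z a :=
  ⟨.ball H ht h.1, (Sg.bex (R := fun z a => ¬ R z a) ht h.2).of_iff fun _ => by simp⟩

theorem Dl.bex (H : HasInduction P) {t : γ → M} {R : γ → M → Prop} (ht : Tm t)
    (h : Dl P fun q : γ × M => R q.1 q.2) : Dl P fun z => ∃ a, a < t z ∧ R z a :=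
  (Dl.not (.ball (R := fun z a => ¬ R z a) H ht h.not)).of_iff fun _ => by simp

theorem Dl.dvd (H : HasInduction P) {s t : γ → M} (hs : Tm s) (ht : Tm t) :
    Dl P fun z => s z ∣ t z := by
  have : Dl P fun z => ∃ a, a < t z + 1 ∧ t z = s z * a :=
    .bex H (.add ht (.const 1)) (Bd.eq ht.fst (.mul hs.fst .snd)).dl
  refine this.of_iff fun z => ⟨fun ⟨a, ha⟩ => ?_, fun ⟨a, _, ha⟩ => ⟨a, ha⟩⟩
  -- If `t z = 0` the given cofactor may be large, and `0` replaces it; otherwise `1 ≤ s z` bounds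
  -- the cofactor by `t z`.
  rcases (zero_le (a := t z)).eq_or_lt with h0 | h0
  · exact ⟨0, by simp [← h0], by simp [← h0]⟩
  · refine ⟨a, (le_of_eq_of_le (one_mul a).symm ?_).trans_lt (lt_add_one _), ha⟩
    rw [ha]
    refine mul_le_mul_left (H.discrete _ ?_) a
    rcases (zero_le (a := s z)).eq_or_lt with h1 | h1
    · simp [ha, ← h1] at h0
    · exact h1

/-! ### Formulas with `Δ₁` set variables -/

/-- Bounded quantifiers preserve `Δ₁` by collection, so `Δ₁` sets may be substituted for set
variables. The sets may depend on `z`, which allows sets coded by quantified conditions. -/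
theorem HasInduction.realize (H : HasInduction P) {k N : ℕ} (φ : BddFormula k N) :
    ∀ {γ : Type u} [Ctx M γ] {X : γ → Fin k → Set M} {w : γ → Fin N → M},
      (∀ i, Dl P fun q : γ × M => q.2 ∈ X q.1 i) → (∀ j, Tm fun z => w z j) →
      Dl P fun z => φ.Realize (X z) (w z) := by
  induction φ with
  | eq s t => exact fun _ hw => (Bd.eq (s.tm hw) (t.tm hw)).dl
  | lt s t => exact fun _ hw => (Bd.lt (s.tm hw) (t.tm hw)).dl
  | mem t i => exact fun hX hw => (hX i).comp (TmMap.id.pair (t.tm hw))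
  | neg _ ih => exact fun hX hw => (ih hX hw).not
  | and _ _ ih₁ ih₂ => exact fun hX hw => (ih₁ hX hw).and (ih₂ hX hw)
  | ball t φ ih =>
    intro γ _ X w hX hw
    refine .ball (R := fun z a => φ.Realize (X z) (Fin.cons a (w z))) H (t.tm hw) ?_
    refine ih (γ := γ × M) (X := fun q => X q.1) (fun i => (hX i).comp .insert) fun j => ?_
    refine Fin.cases ?_ (fun j => ?_) j
    · exact .snd
    · simpa using (hw j).fst

/-- A `Σ₁` set with `Δ₁` set parameters. -/
theorem HasInduction.sg_of_isSigmaOne (H : HasInduction P) {P' : Set (Set M)}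
    (hP' : ∀ A ∈ P', Dl P fun x : M => x ∈ A) {A : Set M} (hA : IsSigmaOne P' A) :
    Sg P fun x : M => x ∈ A := by
  obtain ⟨n, k, φ, p, X, hX, hA⟩ := hA
  refine Sg.of_iff (.ex (H.realize φ (γ := M × M) (X := fun _ => X)
    (w := fun q => Fin.cons q.2 (Fin.cons q.1 p)) (fun i => ?_) fun j => ?_).1) hA
  · exact (hP' _ (hX i)).comp (.of_tm .snd)
  · refine Fin.cases .snd (fun j => ?_) j
    refine Fin.cases Tm.self.fst (fun j => ?_) j
    exact .const (p j)

theorem HasInduction.isSigmaOne_iff (H : HasInduction P) {A : Set M} :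
    IsSigmaOne P A ↔ Sg P fun x : M => x ∈ A :=
  ⟨H.sg_of_isSigmaOne fun _ hB => (Bd.mem hB .self).dl, Sg.isSigmaOne⟩

theorem HasInduction.isDeltaOne_iff (H : HasInduction P) {A : Set M} :
    IsDeltaOne P A ↔ Dl P fun x : M => x ∈ A :=
  and_congr H.isSigmaOne_iff H.isSigmaOne_iff

end Calculus

/-- The set coded by the pair `(m, c)` by means of divisibility. -/
def bits {M : Type u} [CommSemiring M] (m c : M) : Set M := {i | m * (i + 1) + 1 ∣ c}

/-! ### Coding bounded `Σ₁` sets by divisibility -/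

section Coding

variable {M : Type u} [CommSemiring M] [LinearOrder M] [IsStrictOrderedRing M]
  [CanonicallyOrderedAdd M] {P : Set (Set M)}

/-- The least number principle for `Π₁` relations. -/
theorem HasInduction.exists_least (H : HasInduction P) {R : M → Prop} (hR : Sg P fun x => ¬ R x)
    {a : M} (ha : R a) : ∃ x, R x ∧ ∀ y < x, ¬ R y := by
  by_contra! hn
  have key : ∀ x y, y < x → ¬ R y := by
    refine H.induct (.ball H .self (hR.comp (.of_tm .snd)))
      (fun y hy => absurd hy (not_lt.2 zero_le)) ?_
    intro x hx y hy hRy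
    obtain ⟨w, hw, hRw⟩ := hn y hRy
    exact hx w (hw.trans_le (H.lt_add_one_iff.1 hy)) hRw
  exact key _ a (lt_add_one a) ha

theorem dvd_of_dvd_add {a b c : M} (hb : a ∣ b) (h : a ∣ b + c) : a ∣ c := by
  obtain ⟨u, rfl⟩ := hb
  obtain ⟨w, hw⟩ := h
  rcases (zero_le (a := a)).eq_or_lt with rfl | ha
  · have : c = 0 := by simpa using hw
    simp [this]
  · have huw : u ≤ w := le_of_mul_le_mul_left (hw ▸ le_self_add) ha
    obtain ⟨d, rfl⟩ := exists_add_of_le huw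
    rw [mul_add] at hw
    exact ⟨d, add_left_cancel hw⟩

/-- Common multiples of the first values of a term. -/
theorem HasInduction.exists_common_multiple (H : HasInduction P) {f : M → M} (hf : Tm f)
    (hpos : ∀ i, 0 < f i) (b : M) : ∃ c, 0 < c ∧ ∀ i, i < b → f i ∣ c := by
  revert b
  refine H.induct ?_ ⟨1, one_pos, fun i hi => absurd hi (not_lt.2 zero_le)⟩ ?_
  · refine .ex (.and (Bd.lt (.const 0) .snd).sg (.ball H Tm.self.fst ?_))
    exact (Dl.dvd H (hf.comp (.of_tm .snd)) Tm.snd.fst).1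
  · rintro b ⟨c, hc, h⟩
    refine ⟨c * f b, mul_pos hc (hpos b), fun i hi => ?_⟩
    rcases (H.lt_add_one_iff.1 hi).eq_or_lt with rfl | hlt
    · exact dvd_mul_left _ _
    · exact (h i hlt).mul_right _

/-- Modulo `p` the number `m` is invertible, since `m * (j + 1)` is `-1`; without subtraction this
reads `m * c * (j + 1) + c = p * c`. -/
theorem dvd_of_dvd_modulus_mul {m j c p : M} (hp : p = m * (j + 1) + 1) (h : p ∣ m * c) :
    p ∣ c := by
  refine dvd_of_dvd_add (b := m * c * (j + 1)) (h.mul_right _) ⟨c, ?_⟩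
  rw [hp]
  ring

/-- The moduli `m * (i + 1) + 1` are pairwise coprime, provided that `m` is divisible by all the
differences of the indices. -/
theorem modulus_coprime {m i j b c : M} (hm : ∀ d, d < b → d + 1 ∣ m)
    (discrete : ∀ x : M, 0 < x → 1 ≤ x) (hi : i < b) (hj : j < b) (hij : i ≠ j)
    (h : m * (j + 1) + 1 ∣ (m * (i + 1) + 1) * c) : m * (j + 1) + 1 ∣ c := by
  have pos : ∀ {x y : M}, x < y → ∃ d, y = x + (d + 1) := fun {x y} hxy => by
    obtain ⟨e, rfl⟩ := exists_add_of_le hxy.le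
    have he : 0 < e := by simpa using hxy
    obtain ⟨d, rfl⟩ := exists_add_of_le (discrete e he)
    exact ⟨d, by ring⟩
  refine dvd_of_dvd_modulus_mul rfl ?_
  -- Cross-multiplying the moduli by `i + 1` and `j + 1` cancels the terms in `m` and leaves the
  -- difference `d + 1` of the indices. Hence the modulus of `j` divides `(d + 1) * c`, and so `m *
  -- c`, because `d + 1` divides `m`.
  rcases hij.lt_or_gt with hlt | hlt
  · obtain ⟨d, rfl⟩ := pos hlt
    have hd : d < b := (lt_add_one d).trans_le (le_add_self.trans hj.le)
    obtain ⟨e, he⟩ := hm d hd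
    have : m * (i + (d + 1) + 1) + 1 ∣ (d + 1) * c := by
      refine dvd_of_dvd_add (b := (m * (i + (d + 1) + 1) + 1) * ((i + 1) * c)) ⟨_, rfl⟩ ?_
      refine (h.mul_left (i + (d + 1) + 1)).trans (dvd_of_eq ?_)
      ring
    exact (this.mul_left e).trans (dvd_of_eq (by rw [he]; ring))
  · obtain ⟨d, rfl⟩ := pos hlt
    have hd : d < b := (lt_add_one d).trans_le (le_add_self.trans hi.le)
    obtain ⟨e, he⟩ := hm d hd
    have : m * (j + 1) + 1 ∣ (d + 1) * c := by
      refine dvd_of_dvd_add (h.mul_left (j + 1)) ⟨(j + (d + 1) + 1) * c, ?_⟩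
      ring
    exact (this.mul_left e).trans (dvd_of_eq (by rw [he]; ring))

/-- Initial segments of `Σ₁` sets are coded. -/
theorem HasInduction.exists_bits (H : HasInduction P) {A : Set M} (hA : Sg P fun x : M => x ∈ A)
    (b : M) : ∃ m c : M, ∀ i < b, i ∈ A ↔ i ∈ bits m c := by
  obtain ⟨m, hm0, hm⟩ := H.exists_common_multiple (.add .self (.const 1))
    (fun i => add_pos_of_nonneg_of_pos zero_le one_pos) b
  obtain ⟨c₀, hc₀, hdvd⟩ := H.exists_common_multiple
    (.add (.mul (.const m) (.add .self (.const 1))) (.const 1))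
    (fun i => add_pos_of_nonneg_of_pos zero_le one_pos) b
  have hsg : Sg P fun c : M => ¬ 0 < c ∨ ∃ i, i < b ∧ i ∈ A ∧ ¬ m * (i + 1) + 1 ∣ c := by
    refine .or (Bd.lt (.const 0) .self).not.sg (.bex (.const b) ((hA.comp (.of_tm .snd)).and ?_))
    exact (Dl.dvd H (.add (.mul (.const m) (.add .snd (.const 1))) (.const 1)) Tm.self.fst).2
  -- The code is the least positive common multiple of the moduli of the members of `A` below `b`.
  -- Were it divisible by the modulus of a non-member, the quotient would by coprimality be a
  -- smaller one.
  obtain ⟨c, ⟨hc, hcA⟩, hmin⟩ := H.exists_least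
    (R := fun c => 0 < c ∧ ∀ i, i < b → i ∈ A → m * (i + 1) + 1 ∣ c) (hsg.of_iff fun c => by
      rw [not_and_or]
      push Not
      rfl) ⟨hc₀, fun i hi _ => hdvd i hi⟩
  refine ⟨m, c, fun i hi => ⟨hcA i hi, fun hic => by_contra fun hiA => ?_⟩⟩
  obtain ⟨d, rfl⟩ := hic
  have hd : 0 < d := pos_of_mul_pos_right hc zero_le
  refine hmin d ?_ ⟨hd, fun j hj hjA => ?_⟩
  · have : 1 * d < (m * (i + 1) + 1) * d :=
      mul_lt_mul_of_pos_right (lt_add_of_pos_left _ (mul_pos hm0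
        (add_pos_of_nonneg_of_pos zero_le one_pos))) hd
    simpa using this
  · exact modulus_coprime hm H.discrete hi hj (fun e => hiA (e ▸ hjA)) (hcA j hj hjA)

theorem HasInduction.isRegular (H : HasInduction P) {A : Set M}
    (hA : Sg P fun x : M => x ∈ A) : IsRegular A := by
  intro b
  obtain ⟨m, c, h⟩ := H.exists_bits hA b
  refine ⟨b, m, c, fun i => ⟨fun ⟨hi, hb⟩ => ⟨hb, (h i hb).1 hi⟩, fun ⟨hb, hi⟩ => ⟨(h i hb).2 hi, hb⟩⟩⟩

end Coding

/-- Substitution of terms for the variables of a term. -/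
def ArithTerm.subst {n N : ℕ} (f : Fin n → ArithTerm N) : ArithTerm n → ArithTerm N
  | .var i => f i
  | .zero => .zero
  | .one => .one
  | .add s t => .add (s.subst f) (t.subst f)
  | .mul s t => .mul (s.subst f) (t.subst f)

theorem ArithTerm.eval_subst {M : Type u} [CommSemiring M] {n N : ℕ} (f : Fin n → ArithTerm N)
    (s : ArithTerm n) (v : Fin N → M) : (s.subst f).eval v = s.eval fun i => (f i).eval v := by
  induction s with
  | var i => rfl
  | zero => rfl
  | one => rfl
  | add _ _ h₁ h₂ => simp [subst, eval, h₁, h₂]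
  | mul _ _ h₁ h₂ => simp [subst, eval, h₁, h₂]

/-! ### Finite conditions and forcing of induction -/

section Forcing

variable {M : Type u} [CommSemiring M] [LinearOrder M]

/-- A finite initial segment of a set to be constructed: below `len` it agrees with the set coded
by `modulus` and `code`. -/
structure Cond (M : Type u) where
  len : M
  modulus : M
  code : M

/-- The set coded by a condition. -/
def Cond.set (σ : Cond M) : Set M := bits σ.modulus σ.code

/-- `τ` extends `σ`, and its new values on `D` are those of `C`. -/
def Cond.Ext (D C : Set M) (σ τ : Cond M) : Prop :=
  σ.len ≤ τ.len ∧ ∀ z < τ.len,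
    (z < σ.len → (z ∈ τ.set ↔ z ∈ σ.set)) ∧ (σ.len ≤ z → z ∈ D → (z ∈ τ.set ↔ z ∈ C))

theorem Cond.Ext.refl (D C : Set M) (σ : Cond M) : σ.Ext D C σ :=
  ⟨le_rfl, fun _ hz => ⟨fun _ => Iff.rfl, fun h => absurd hz h.not_gt⟩⟩

theorem Cond.Ext.trans {D C : Set M} {σ τ ρ : Cond M} (h₁ : σ.Ext D C τ) (h₂ : τ.Ext D C ρ) :
    σ.Ext D C ρ := by
  refine ⟨h₁.1.trans h₂.1, fun z hz => ⟨fun hl => ?_, fun hl hD => ?_⟩⟩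
  · have hz' := hl.trans_le h₁.1
    exact ((h₂.2 z hz).1 hz').trans ((h₁.2 z hz').1 hl)
  · rcases lt_or_ge z τ.len with hz' | hz'
    · exact ((h₂.2 z hz).1 hz').trans ((h₁.2 z hz').2 hl hD)
    · exact (h₂.2 z hz).2 hz' hD

/-- Promises only grow along the construction, so an extension made at a late stage also respects
the earlier ones. -/
theorem Cond.Ext.mono {D C D' C' : Set M} {σ τ : Cond M} (h : σ.Ext D' C' τ) (hD : D ⊆ D')
    (hC : ∀ z ∈ D, z ∈ C' ↔ z ∈ C) : σ.Ext D C τ :=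
  ⟨h.1, fun z hz => ⟨(h.2 z hz).1, fun hl hzD => ((h.2 z hz).2 hl (hD hzD)).trans (hC z hzD)⟩⟩

variable [IsStrictOrderedRing M] [CanonicallyOrderedAdd M] {P : Set (Set M)}

theorem ArithTerm.eval_mono {n : ℕ} (s : ArithTerm n) {v w : Fin n → M} (h : ∀ i, v i ≤ w i) :
    s.eval v ≤ s.eval w := by
  induction s with
  | var i => exact h i
  | zero => exact le_rfl
  | one => exact le_rfl
  | add _ _ h₁ h₂ => exact add_le_add h₁ h₂
  | mul _ _ h₁ h₂ => exact mul_le_mul' h₁ h₂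

/-- The truth of a bounded formula depends only on initial segments of the sets in it, and
their lengths are bounded by a term. -/
theorem BddFormula.exists_use (M : Type u) [CommSemiring M] [LinearOrder M] [IsStrictOrderedRing M]
    [CanonicallyOrderedAdd M] {k N : ℕ} (φ : BddFormula k N) : ∃ u : ArithTerm N,
    ∀ (v : Fin N → M) (X Y : Fin k → Set M), (∀ i, ∀ z < u.eval v, z ∈ X i ↔ z ∈ Y i) →
      (φ.Realize X v ↔ φ.Realize Y v) := by
  induction φ with
  | eq s t => exact ⟨.zero, fun v X Y _ => Iff.rfl⟩
  | lt s t => exact ⟨.zero, fun v X Y _ => Iff.rfl⟩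
  | mem t i => exact ⟨.add t .one, fun v X Y h => h i _ (lt_add_one _)⟩
  | neg _ ih =>
    obtain ⟨u, hu⟩ := ih
    exact ⟨u, fun v X Y h => not_congr (hu v X Y h)⟩
  | and _ _ ih₁ ih₂ =>
    obtain ⟨u₁, hu₁⟩ := ih₁
    obtain ⟨u₂, hu₂⟩ := ih₂
    exact ⟨.add u₁ u₂, fun v X Y h => and_congr
      (hu₁ v X Y fun i z hz => h i z (hz.trans_le le_self_add))
      (hu₂ v X Y fun i z hz => h i z (hz.trans_le le_add_self))⟩
  | ball t φ ih =>
    obtain ⟨u, hu⟩ := ih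
    -- Terms are monotone, so putting the bound `t` for the bound variable dominates the use at
    -- every `a < t`.
    refine ⟨u.subst (Fin.cons t .var), fun v X Y h => forall_congr' fun a => imp_congr_right
      fun ha => hu _ X Y fun i z hz => h i z (hz.trans_le ?_)⟩
    rw [ArithTerm.eval_subst]
    refine u.eval_mono fun j => ?_
    refine Fin.cases ?_ (fun j => ?_) j
    · exact ha.le
    · exact le_rfl

theorem HasInduction.bits_dl (H : HasInduction P) {γ : Type u} [Ctx M γ] {s m c : γ → M}
    (hs : Tm s) (hm : Tm m) (hc : Tm c) : Dl P fun z => s z ∈ bits (m z) (c z) :=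
  Dl.dvd H (.add (.mul hm (.add hs (.const 1))) (.const 1)) hc

/-- Extensions of any length exist. -/
theorem Cond.exists_ext (H : HasInduction P) {D C : Set M} (hD : Dl P fun x : M => x ∈ D)
    (hC : Dl P fun x : M => x ∈ C) (σ : Cond M) (a : M) : ∃ τ, σ.Ext D C τ ∧ a ≤ τ.len := by
  have : Sg P fun z : M => z ∈ {z | (z < σ.len ∧ z ∈ σ.set) ∨ (¬ z < σ.len ∧ z ∈ D ∧ z ∈ C)} :=
    (Dl.or (.and (Bd.lt .self (.const _)).dl (H.bits_dl .self (.const _) (.const _)))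
      (.and (Bd.lt .self (.const _)).dl.not (hD.and hC))).1
  obtain ⟨m, c, h⟩ := H.exists_bits this (max σ.len a)
  refine ⟨⟨max σ.len a, m, c⟩, ⟨le_max_left _ _, fun z hz => ⟨fun hl => ?_, fun hl hzD => ?_⟩⟩,
    le_max_right _ _⟩
  · refine (h z hz).symm.trans ?_
    simp [hl]
  · refine (h z hz).symm.trans ?_
    simp [hl.not_gt, hl, hzD]

/-- The instance at `a` of induction for the formula `∃ y, φ(y, x, p)` with set parameter `B`. -/
def InductionAt {n k : ℕ} (φ : BddFormula k (n + 2)) (p : Fin n → M) (a : M) (B : Set M) : Prop :=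
  (∃ y, φ.Realize (fun _ => B) (Fin.cons y (Fin.cons 0 p))) →
  (∀ x, (∃ y, φ.Realize (fun _ => B) (Fin.cons y (Fin.cons x p))) →
    ∃ y, φ.Realize (fun _ => B) (Fin.cons y (Fin.cons (x + 1) p))) →
  ∃ y, φ.Realize (fun _ => B) (Fin.cons y (Fin.cons a p))

/-- Every condition has an extension that forces a given instance of induction. -/
theorem Cond.exists_ext_induction (H : HasInduction P) {D C : Set M}
    (hD : Dl P fun x : M => x ∈ D) (hC : Dl P fun x : M => x ∈ C) (σ : Cond M)
    {n k : ℕ} (φ : BddFormula k (n + 2)) (p : Fin n → M) (a : M) :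
    ∃ τ, σ.Ext D C τ ∧ ∀ B : Set M,
      (∀ b, ∃ ρ, τ.Ext D C ρ ∧ b ≤ ρ.len ∧ ∀ z < ρ.len, z ∈ B ↔ z ∈ ρ.set) →
      InductionAt φ p a B := by
  obtain ⟨u, hu⟩ := φ.exists_use M
  -- `F τ x`: the condition `τ` has a witness `y` below its length and is long enough to cover the
  -- use of `φ` there. Both bounds keep `F` a `Δ₁` relation.
  let F : Cond M → M → Prop := fun τ x => ∃ y, y < τ.len ∧
    (u.eval (Fin.cons y (Fin.cons x p)) ≤ τ.len ∧
      φ.Realize (fun _ => τ.set) (Fin.cons y (Fin.cons x p)))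
  let Q : M → Prop := fun x => ∃ l m c, σ.Ext D C ⟨l, m, c⟩ ∧ ∀ x', x' < x + 1 → F ⟨l, m, c⟩ x'
  -- what a condition forces holds, and what holds is forced by long conditions
  have hF : ∀ {B : Set M} {τ : Cond M} {x : M}, (∀ z < τ.len, z ∈ B ↔ z ∈ τ.set) → F τ x →
      ∃ y, φ.Realize (fun _ => B) (Fin.cons y (Fin.cons x p)) := by
    rintro B τ x hB ⟨y, -, hy, h⟩
    exact ⟨y, (hu _ (fun _ => B) (fun _ => τ.set) fun _ z hz => hB z (hz.trans_le hy)).2 h⟩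
  have hF' : ∀ {B : Set M} {τ : Cond M} {x y : M}, (∀ z < τ.len, z ∈ B ↔ z ∈ τ.set) →
      φ.Realize (fun _ => B) (Fin.cons y (Fin.cons x p)) →
      y + 1 + u.eval (Fin.cons y (Fin.cons x p)) ≤ τ.len → F τ x := by
    intro B τ x y hB h hl
    have hul : u.eval (Fin.cons y (Fin.cons x p)) ≤ τ.len := le_add_self.trans hl
    exact ⟨y, (lt_add_one y).trans_le (le_self_add.trans hl), hul,
      (hu _ (fun _ => B) (fun _ => τ.set) fun _ z hz => hB z (hz.trans_le hul)).1 h⟩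
  have hmono : ∀ {τ ρ : Cond M} {x : M}, τ.Ext D C ρ → F τ x → F ρ x := by
    rintro τ ρ x h ⟨y, hy, hy', hr⟩
    refine ⟨y, hy.trans_le h.1, hy'.trans h.1, ?_⟩
    exact (hu _ (fun _ => ρ.set) (fun _ => τ.set) fun _ z hz =>
      (h.2 z ((hz.trans_le hy').trans_le h.1)).1 (hz.trans_le hy')).2 hr
  have hExt : Dl P fun q : ((M × M) × M) × M => σ.Ext D C ⟨q.1.1.2, q.1.2, q.2⟩ := by
    refine .and (.le (.const _) Tm.snd.fst.fst)
      (.ball H Tm.snd.fst.fst (.and (.imp ?_ (.iff ?_ ?_)) (.imp ?_ (.imp ?_ (.iff ?_ ?_)))))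
    · exact (Bd.lt .snd (.const _)).dl
    · exact H.bits_dl .snd Tm.snd.fst.fst Tm.snd.fst
    · exact H.bits_dl .snd (.const _) (.const _)
    · exact .le (.const _) .snd
    · exact hD.comp (.of_tm .snd)
    · exact H.bits_dl .snd Tm.snd.fst.fst Tm.snd.fst
    · exact hC.comp (.of_tm .snd)
  have hvar : ∀ j, Tm fun q : ((((M × M) × M) × M) × M) × M =>
      (Fin.cons q.2 (Fin.cons q.1.2 p) : Fin (n + 2) → M) j := fun j => by
    refine Fin.cases .snd (fun j => ?_) j
    exact Fin.cases Tm.snd.fst (fun j => .const (p j)) j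
  have hQ : Sg P Q := by
    refine .ex (.ex (.ex (.and hExt.1 (Dl.ball H (.add Tm.self.fst.fst.fst (.const 1)) ?_).1)))
    refine .bex H Tm.snd.fst.fst.fst (.and (.le (u.tm hvar) Tm.snd.fst.fst.fst.fst) ?_)
    exact H.realize φ (fun i => H.bits_dl .snd Tm.snd.fst.fst.fst.fst Tm.snd.fst.fst.fst) hvar
  by_cases hQa : Q a
  · obtain ⟨l, m, c, hτ, h⟩ := hQa
    refine ⟨_, hτ, fun B hB _ _ => ?_⟩
    obtain ⟨ρ, hρ, -, hB⟩ := hB 0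
    exact hF hB (hmono hρ (h a (lt_add_one a)))
  by_cases hQ0 : Q 0
  -- If the induction step held for `B` at `x`, a long enough piece of `B` would force the formula
  -- at `x + 1` too, which contradicts the failure of `Q (x + 1)`.
  · obtain ⟨x, hx, hx'⟩ : ∃ x, Q x ∧ ¬ Q (x + 1) := by
      by_contra! hn
      exact hQa (H.induct hQ hQ0 hn a)
    obtain ⟨l, m, c, hτ, h⟩ := hx
    refine ⟨_, hτ, fun B hB _ hs => (hx' ?_).elim⟩
    have hx : ∃ y, φ.Realize (fun _ => B) (Fin.cons y (Fin.cons x p)) := by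
      obtain ⟨ρ, hρ, -, hB⟩ := hB 0
      exact hF hB (hmono hρ (h x (lt_add_one x)))
    obtain ⟨y, hy⟩ := hs x hx
    obtain ⟨ρ, hρ, hl, hB⟩ := hB _
    refine ⟨ρ.len, ρ.modulus, ρ.code, hτ.trans hρ, fun x' hx' => ?_⟩
    rcases (H.lt_add_one_iff.1 hx').eq_or_lt with rfl | hlt
    · exact hF' hB hy hl
    · exact hmono hρ (h x' hlt)
  -- Here `σ` itself suffices: a witness for the base case in `B` would be forced by a long piece of
  -- `B`, giving `Q 0`.
  · refine ⟨σ, .refl D C σ, fun B hB ⟨y, hy⟩ _ => (hQ0 ?_).elim⟩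
    obtain ⟨ρ, hρ, hl, hB⟩ := hB _
    refine ⟨ρ.len, ρ.modulus, ρ.code, hρ, fun x' hx' => ?_⟩
    obtain rfl : x' = 0 := le_antisymm (H.lt_add_one_iff.1 hx') zero_le
    exact hF' hB hy hl

end Forcing

/-! ### Countability of the formulas -/

def ArithTerm.code {n : ℕ} : ArithTerm n → ℕ
  | .var i => Nat.pair 0 i
  | .zero => Nat.pair 1 0
  | .one => Nat.pair 2 0
  | .add s t => Nat.pair 3 (Nat.pair s.code t.code)
  | .mul s t => Nat.pair 4 (Nat.pair s.code t.code)

theorem ArithTerm.code_injective {n : ℕ} : ∀ {s t : ArithTerm n}, s.code = t.code → s = t := by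
  intro s
  induction s <;> rintro (_ | _ | _ | _ | _) h <;> simp [code, Nat.pair_eq_pair] at h ⊢
  case var.var => exact Fin.ext h
  case add.add h₁ h₂ _ _ => exact ⟨h₁ h.1, h₂ h.2⟩
  case mul.mul h₁ h₂ _ _ => exact ⟨h₁ h.1, h₂ h.2⟩

def BddFormula.code {k : ℕ} : {n : ℕ} → BddFormula k n → ℕ
  | _, .eq s t => Nat.pair 0 (Nat.pair s.code t.code)
  | _, .lt s t => Nat.pair 1 (Nat.pair s.code t.code)
  | _, .mem t i => Nat.pair 2 (Nat.pair t.code i)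
  | _, .neg φ => Nat.pair 3 φ.code
  | _, .and φ ψ => Nat.pair 4 (Nat.pair φ.code ψ.code)
  | _, .ball t φ => Nat.pair 5 (Nat.pair t.code φ.code)

theorem BddFormula.code_injective {k n : ℕ} :
    ∀ {φ ψ : BddFormula k n}, φ.code = ψ.code → φ = ψ := by
  intro φ
  induction φ <;> rintro (_ | _ | _ | _ | _ | _) h <;> simp [code, Nat.pair_eq_pair] at h ⊢
  case eq.eq => exact ⟨ArithTerm.code_injective h.1, ArithTerm.code_injective h.2⟩
  case lt.lt => exact ⟨ArithTerm.code_injective h.1, ArithTerm.code_injective h.2⟩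
  case mem.mem => exact ⟨ArithTerm.code_injective h.1, Fin.ext h.2⟩
  case neg.neg ih _ => exact ih h
  case and.and h₁ h₂ _ _ => exact ⟨h₁ h.1, h₂ h.2⟩
  case ball.ball ih _ _ => exact ⟨ArithTerm.code_injective h.1, ih h.2⟩

instance (k n : ℕ) : Countable (BddFormula k n) :=
  Function.Injective.countable (f := BddFormula.code) fun _ _ => BddFormula.code_injective

theorem countable_isSigmaOne {M : Type u} [CommSemiring M] [LinearOrder M] [Countable M]
    (B : Set M) : {A : Set M | IsSigmaOne {B} A}.Countable := by
  refine (Set.countable_range fun r : Σ (n k : ℕ), BddFormula k (n + 2) × (Fin n → M) =>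
    {x | ∃ y, r.2.2.1.Realize (fun _ => B) (Fin.cons y (Fin.cons x r.2.2.2))}).mono ?_
  rintro A ⟨n, k, φ, p, X, hX, hA⟩
  obtain rfl : X = fun _ => B := funext hX
  exact ⟨⟨n, k, φ, p⟩, (Set.ext hA).symm⟩

/-! ### The generic set and the topped extension -/

section Topped

variable {M : Type u} [CommSemiring M] [LinearOrder M] [IsStrictOrderedRing M]
  [CanonicallyOrderedAdd M] {P : Set (Set M)}

/-- A set that meets all instances of `Σ₁` induction and that agrees with `C i` on almost all
of `D i`, for an increasing sequence of sets `D i`. -/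
theorem HasInduction.exists_generic [Countable M] (H : HasInduction P) {D C : ℕ → Set M}
    (hD : ∀ i, Dl P fun x : M => x ∈ D i) (hC : ∀ i, Dl P fun x : M => x ∈ C i)
    (hmono : ∀ i j, i ≤ j → D i ⊆ D j) (hcomp : ∀ i j, i ≤ j → ∀ z ∈ D i, z ∈ C j ↔ z ∈ C i) :
    ∃ B : Set M, (∀ (n k : ℕ) (φ : BddFormula k (n + 2)) (p : Fin n → M) (a : M),
      InductionAt φ p a B) ∧ ∀ i, ∃ l, ∀ z, l ≤ z → z ∈ D i → (z ∈ B ↔ z ∈ C i) := by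
  -- Stage `j` treats the instance `r j`, if any, and makes the condition at least `e j` long, so
  -- that the lengths are cofinal in `M`.
  obtain ⟨r, hr⟩ := exists_surjective_nat
    (Option (Σ (n k : ℕ), BddFormula k (n + 2) × (Fin n → M) × M))
  obtain ⟨e, he⟩ := exists_surjective_nat M
  have step : ∀ (j : ℕ) (σ : Cond M), ∃ τ : Cond M, σ.Ext (D j) (C j) τ ∧ e j ≤ τ.len ∧
      ∀ n k φ p a, r j = some ⟨n, k, φ, p, a⟩ → ∀ B : Set M,
      (∀ b, ∃ ρ, τ.Ext (D j) (C j) ρ ∧ b ≤ ρ.len ∧ ∀ z < ρ.len, z ∈ B ↔ z ∈ ρ.set) →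
      InductionAt φ p a B := by
    intro j σ
    obtain ⟨τ, hτ, hl⟩ := Cond.exists_ext H (hD j) (hC j) σ (e j)
    rcases hj : r j with _ | ⟨n, k, φ, p, a⟩
    · exact ⟨τ, hτ, hl, by simp⟩
    · obtain ⟨τ', hτ', h⟩ := Cond.exists_ext_induction H (hD j) (hC j) τ φ p a
      refine ⟨τ', hτ.trans hτ', hl.trans hτ'.1, ?_⟩
      rintro n' k' φ' p' a' ⟨⟩
      exact h
  choose next hext hlen hind using step
  let σ : ℕ → Cond M := fun j => Nat.rec ⟨0, 0, 0⟩ next j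
  have hσ : ∀ i j, i ≤ j → (σ i).Ext (D i) (C i) (σ j) := by
    intro i j hij
    induction j, hij using Nat.le_induction with
    | base => exact .refl _ _ _
    | succ j hij ih => exact ih.trans ((hext j (σ j)).mono (hmono i j hij) (hcomp i j hij))
  let B : Set M := {z | ∃ j, z < (σ j).len ∧ z ∈ (σ j).set}
  have hB : ∀ j, ∀ z < (σ j).len, z ∈ B ↔ z ∈ (σ j).set := by
    refine fun j z hz => ⟨fun ⟨i, hi, hzi⟩ => ?_, fun h => ⟨j, hz, h⟩⟩
    rcases le_total i j with hij | hij
    · exact (((hσ i j hij).2 z hz).1 hi).2 hzi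
    · exact (((hσ j i hij).2 z hi).1 hz).1 hzi
  have hlong : ∀ b i, ∃ j, i ≤ j ∧ b ≤ (σ j).len := by
    intro b i
    obtain ⟨j, rfl⟩ := he b
    exact ⟨max i (j + 1), le_max_left _ _,
      (hlen j (σ j)).trans (hσ (j + 1) _ (le_max_right _ _)).1⟩
  refine ⟨B, fun n k φ p a => ?_, fun i => ⟨(σ i).len, fun z hl hz => ?_⟩⟩
  · obtain ⟨j, hj⟩ := hr (some ⟨n, k, φ, p, a⟩)
    refine hind j (σ j) n k φ p a hj B fun b => ?_
    obtain ⟨i, hi, hb⟩ := hlong b (j + 1)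
    exact ⟨σ i, (hσ (j + 1) i hi).mono (hmono j _ j.le_succ) (hcomp j _ j.le_succ), hb, hB i⟩
  · obtain ⟨j, hj, hb⟩ := hlong (z + 1) i
    have hzj : z < (σ j).len := (lt_add_one z).trans_le hb
    exact (hB j z hzj).trans (((hσ i j hj).2 z hzj).2 hl hz)

/-- The union of the first `n` sets `A i`, copied into the disjoint columns
`{2 ^ i * (2 * x + 1) : x ∈ M}`. -/
def columns (A : ℕ → Set M) (n : ℕ) : Set M :=
  {z | ∃ i < n, ∃ x ∈ A i, z = 2 ^ i * (2 * x + 1)}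

/-- Discreteness keeps odd numbers from being even. The exponents are standard, so factors of `2`
can be cancelled one at a time. -/
theorem column_injective (discrete : ∀ x : M, 0 < x → 1 ≤ x) :
    ∀ {i j : ℕ} {x y : M}, (2 : M) ^ i * (2 * x + 1) = 2 ^ j * (2 * y + 1) → i = j ∧ x = y := by
  have parity : ∀ x y : M, 2 * x + 1 ≠ 2 * y := by
    intro x y h
    have hxy : x < y := lt_of_mul_lt_mul_left (h ▸ lt_add_one (2 * x)) zero_le
    obtain ⟨d, rfl⟩ := exists_add_of_le hxy.le
    have hd : 1 ≤ d := discrete d (by simpa using hxy)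
    have : 2 * x + 1 < 2 * (x + d) := by
      calc 2 * x + 1 < 2 * x + 1 + 1 := lt_add_one _
        _ = 2 * x + 2 * 1 := by ring
        _ ≤ 2 * x + 2 * d := by gcongr
        _ = _ := by ring
    exact this.ne h
  have h2 : (2 : M) ≠ 0 := two_ne_zero
  intro i
  induction i with
  | zero =>
    rintro (_ | j) x y h
    · exact ⟨rfl, mul_left_cancel₀ h2 (by simpa using h : 2 * x = 2 * y)⟩
    · exact absurd (by rw [← mul_assoc, ← pow_succ', ← h, pow_zero, one_mul])
        (parity x (2 ^ j * (2 * y + 1)))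
  | succ i ih =>
    rintro (_ | j) x y h
    · exact absurd (by rw [← mul_assoc, ← pow_succ', h, pow_zero, one_mul])
        (parity y (2 ^ i * (2 * x + 1)))
    · rw [pow_succ', pow_succ', mul_assoc, mul_assoc] at h
      obtain ⟨rfl, rfl⟩ := ih (mul_left_cancel₀ h2 h)
      exact ⟨rfl, rfl⟩

theorem le_column (i : ℕ) (x : M) : x ≤ 2 ^ i * (2 * x + 1) :=
  calc x ≤ 2 * x := le_mul_of_one_le_left zero_le one_le_two
    _ ≤ 2 * x + 1 := le_self_add
    _ ≤ 2 ^ i * (2 * x + 1) := le_mul_of_one_le_left zero_le (one_le_pow₀ one_le_two)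

theorem HasInduction.columns_dl (H : HasInduction P) {A : ℕ → Set M}
    (hA : ∀ i, Dl P fun x : M => x ∈ A i) (n : ℕ) : Dl P fun x : M => x ∈ columns A n := by
  induction n with
  | zero =>
    exact (Bd.lt (.const (0 : M)) (.const 0)).dl.of_iff fun z => by simp [columns]
  | succ n ih =>
    have : Dl P fun z : M => z ∈ columns A n ∨
        ∃ x, x < z + 1 ∧ (x ∈ A n ∧ z = 2 ^ n * (2 * x + 1)) :=
      .or ih (.bex H (.add .self (.const 1)) (((hA n).comp (.of_tm .snd)).and
        (Bd.eq Tm.self.fst (.mul (.const _) (.add (.mul (.const 2) .snd) (.const 1)))).dl))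
    refine this.of_iff fun z => ⟨?_, ?_⟩
    · rintro ⟨i, hi, x, hx, rfl⟩
      rcases (Nat.lt_succ_iff_lt_or_eq.1 hi) with hi | rfl
      · exact Or.inl ⟨i, hi, x, hx, rfl⟩
      · exact Or.inr ⟨x, (le_column i x).trans_lt (lt_add_one _), hx, rfl⟩
    · rintro (⟨i, hi, x, hx, rfl⟩ | ⟨x, -, hx, rfl⟩)
      · exact ⟨i, hi.trans n.lt_succ_self, x, hx, rfl⟩
      · exact ⟨n, n.lt_succ_self, x, hx, rfl⟩

/-- If `Σ₁` induction holds with set parameters from the countable set `P`, then it holds with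
a set parameter in which all members of `P` are `Δ₁`. -/
theorem HasInduction.exists_top [Countable M] (H : HasInduction P) (hP : P.Countable)
    (hne : P.Nonempty) : ∃ B : Set M, HasInduction {B} ∧ ∀ A ∈ P, IsDeltaOne {B} A := by
  obtain ⟨A, rfl⟩ := hP.exists_eq_range hne
  have hA : ∀ i, Dl (Set.range A) fun x : M => x ∈ A i := fun i =>
    (Bd.mem (Set.mem_range_self i) .self).dl
  obtain ⟨B, hind, hB⟩ := H.exists_generic
    (H.columns_dl (A := fun _ => Set.univ) fun _ => (Bd.eq .self .self).dl.of_iff fun _ => by simp)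
    (H.columns_dl hA) (by
      rintro i j hij z ⟨n, hn, h⟩
      exact ⟨n, hn.trans_le hij, h⟩) (by
      rintro i j hij _ ⟨n, hn, x, -, rfl⟩
      refine ⟨fun ⟨n', hn', x', hx', e⟩ => ?_, fun ⟨n', hn', h⟩ => ⟨n', hn'.trans_le hij, h⟩⟩
      obtain ⟨rfl, rfl⟩ := column_injective H.discrete e
      exact ⟨n, hn, x, hx', rfl⟩)
  have HB : HasInduction {B} := by
    refine ⟨H.discrete, ?_⟩
    rintro A ⟨n, k, φ, p, X, hX, hA⟩ h0 hs a
    obtain rfl : X = fun _ => B := funext hX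
    exact (hA a).2 (hind n k φ p a ((hA 0).1 h0) fun x hx => (hA _).1 (hs x ((hA x).2 hx)))
  refine ⟨B, HB, ?_⟩
  rintro _ ⟨i, rfl⟩
  -- Column `i` is promised from stage `i + 1` on. Beyond `l` membership in `A i` is read off from
  -- `B`; below `l` it is supplied by the code `m, c`.
  obtain ⟨l, hl⟩ := hB (i + 1)
  obtain ⟨m, c, hmc⟩ := H.exists_bits (hA i).1 l
  have : Dl {B} fun x : M => (x < l ∧ x ∈ bits m c) ∨ (¬ x < l ∧ 2 ^ i * (2 * x + 1) ∈ B) :=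
    .or (.and (Bd.lt .self (.const l)).dl (HB.bits_dl .self (.const m) (.const c)))
      (.and (Bd.lt .self (.const l)).dl.not
        (Bd.mem (Set.mem_singleton B) (.mul (.const _) (.add (.mul (.const 2) .self) (.const 1)))).dl)
  refine HB.isDeltaOne_iff.2 (this.of_iff fun x => ?_)
  rcases lt_or_ge x l with hx | hx
  · simp [hx, hmc x hx]
  -- The entry for `x` in its column is at least `x`, hence beyond `l`.
  · have := hl (2 ^ i * (2 * x + 1)) (hx.trans (le_column i x)) ⟨i, i.lt_succ_self, x, trivial, rfl⟩
    rw [this]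
    simp only [hx.not_gt, false_and, not_false_eq_true, true_and, false_or]
    refine ⟨fun h => ⟨i, i.lt_succ_self, x, h, rfl⟩, fun ⟨n, hn, x', hx', e⟩ => ?_⟩
    obtain ⟨rfl, rfl⟩ := column_injective H.discrete e
    exact hx'

end Topped

/-- Every countable model of `RCA₀` has a topped extension with the same first-order part. -/
theorem IsModelRCA0.exists_topped_extension {M : Type u} [CommSemiring M] [LinearOrder M]
    [IsStrictOrderedRing M] [CanonicallyOrderedAdd M] [Countable M] {S : Set (Set M)} (hS : S.Countable)
    (hM : IsModelRCA0 S) :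
    ∃ (S' : Set (Set M)) (B : Set M),
      S ⊆ S' ∧ S'.Countable ∧ IsModelRCA0 S' ∧
      IsToppedBy S' B ∧
      (∀ A : Set M, IsSigmaOne S' A → IsRegular A) ∧
      (∀ U : BddFormula 1 3, IsUniversal M U →
        IsRegular (jump U B)) := by
  have H : HasInduction S := ⟨hM.discrete, hM.sigma_one_induction⟩
  have hne : S.Nonempty := ⟨Set.univ, hM.delta_one_comprehension _
    (H.isDeltaOne_iff.2 ((Bd.eq .self .self).dl.of_iff fun _ => by simp))⟩
  obtain ⟨B, HB, hSB⟩ := H.exists_top hS hne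
  have hsg : ∀ A, IsSigmaOne {A | IsDeltaOne {B} A} A → Sg {B} fun x : M => x ∈ A :=
    fun A => HB.sg_of_isSigmaOne fun _ => HB.isDeltaOne_iff.1
  refine ⟨{A | IsDeltaOne {B} A}, B, hSB, (countable_isSigmaOne B).mono fun A hA => hA.1,
    ⟨hM.discrete, fun A hA => ?_, fun A hA => ?_⟩, ⟨?_, fun A hA => hA⟩,
    fun A hA => HB.isRegular (hsg A hA), fun U _ => HB.isRegular ?_⟩
  · exact HB.isDeltaOne_iff.2 ⟨hsg A hA.1, hsg Aᶜ hA.2⟩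
  · exact HB.induction A (hsg A hA).isSigmaOne
  · exact HB.isDeltaOne_iff.2 (Bd.mem (Set.mem_singleton B) .self).dl
  · refine .ex (HB.realize U (γ := M × M) (X := fun _ _ => B) (w := fun q => ![q.2, q.1, q.1])
      (fun _ => (Bd.mem (Set.mem_singleton B) .snd).dl) fun j => ?_).1
    fin_cases j
    · exact .snd
    · exact Tm.self.fst
    · exact Tm.self.fst

end SecondOrderArith

theorem lemmaB2 {M : Type u} [CommSemiring M] [LinearOrder M] [IsStrictOrderedRing M]
    [CanonicallyOrderedAdd M] [Countable M] (S : Set (Set M)) (hS : S.Countable)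
    (hM : SecondOrderArith.IsModelRCA0 S) :
    ∃ (S' : Set (Set M)) (B : Set M),
      S ⊆ S' ∧ S'.Countable ∧ SecondOrderArith.IsModelRCA0 S' ∧
      SecondOrderArith.IsToppedBy S' B ∧
      (∀ A : Set M, SecondOrderArith.IsSigmaOne S' A → SecondOrderArith.IsRegular A) ∧
      (∀ U : SecondOrderArith.BddFormula 1 3, SecondOrderArith.IsUniversal M U →
        SecondOrderArith.IsRegular (SecondOrderArith.jump U B)) := by
  exact hM.exists_topped_extension hS
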